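/- For $a>0$ let $f:\mathbb{R}\to\mathbb{R}$ be the truncation function $f(x)=x$ if $|x|\le a$ and $f(x)=0$ if $|x|>a$. For $\alpha\in\mathbb{R}^n$ let $p(x)=\sum_{i=1}^n\alpha_i x_i$, and for $x\in\mathbb{R}^n$ write $f(x)=(f(x_1),\dots,f(x_n))$. There are universal constants $c,C>0$ (independent of $n$, $\alpha$, $a$ and $\delta$) such that: 1. For every $n\ge 0$, every $\alpha\in\mathbb{R}^n$, every $a>0$ and every $\delta\in(0,1]$, $$\Pr_{x\sim\mathcal N(0,I_n)}\big[\,|p(f(x))|\le\min\{a,0.1\}\cdot\delta\cdot\|\alpha\|_2\,\big]\ \ge\ c\,\delta .$$ 2. (Anti-concentration of sums of truncated Gaussians.) For every $n\ge 1$, every $\alpha\in\mathbb{R}^n\setminus\{0\}$, every $a>0$ and every $\delta>0$, $$\Pr_{x\sim\mathcal N(0,I_n)}\Big[\,|p(f(x))|\le\min\{a,0.1\}\cdot\delta\cdot\|\alpha\|_2\ \Big|\ |x_i|\le a \text{ for all } i\Big]\ \le\ C\,\delta ,$$ that is, the bound holds when the coordinates of $x$ are i.i.d. with the standard Gaussian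 law conditioned on $[-a,a]$ (on this event $f(x)=x$). -/

import Mathlib

open MeasureTheory ProbabilityTheory

noncomputable section

/-- The truncation function at level `a`: it keeps `x` if `|x| ≤ a` and returns `0` otherwise. -/
def trunc (a x : ℝ) : ℝ := if |x| ≤ a then x else 0

/-- The linear form `p(x) = ∑ i, α i * x i`. -/
def linForm {n : ℕ} (α : EuclideanSpace ℝ (Fin n)) (x : Fin n → ℝ) : ℝ := ∑ i, α i * x i

/-- The law of `n` i.i.d. standard Gaussian random variables. -/
def stdGaussianLaw (n : ℕ) : Measure (Fin n → ℝ) := Measure.pi fun _ => gaussianReal 0 1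

/-- The law of `n` i.i.d. Gaussians truncated at level `a`: the standard Gaussian law
conditioned on all coordinates being at most `a` in absolute value. -/
def truncGaussianLaw (n : ℕ) (a : ℝ) : Measure (Fin n → ℝ) :=
  cond (stdGaussianLaw n) {x | ∀ i, |x i| ≤ a}

/-- The event `|p(f(x))| ≤ min{a, 0.1} · δ · ‖α‖₂`, with `f = trunc a` applied coordinatewise. -/
def smallBall {n : ℕ} (α : EuclideanSpace ℝ (Fin n)) (a δ : ℝ) : Set (Fin n → ℝ) :=
  {x | |linForm α (fun i => trunc a (x i))| ≤ min a (1 / 10) * δ * ‖α‖}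

end

/-!
Call a measure on `ℝ` symmetric unimodal if averaging over its translates preserves the even
functions that are nonincreasing in `|x|`. By Fubini this class is closed under convolution, so
sums of independent symmetric unimodal variables stay in it; the truncated Gaussians belong to it.

*Lower bound.* By Chebyshev, a law of variance at most `σ²` gives mass at least `3/4` to some
interval of length `4σ`. Covering that interval by translates of `[-s, s]`, which under a symmetric
unimodal law is the heaviest interval of its length, bounds the mass of `[-s, s]` below by a
multiple of `s / σ`.

*Upper bound.* A law with density at most `M` is less peaked than the uniform law on an interval of
length `1 / M`, and this in turn is less peaked than the convolution of two uniform laws of half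
the width. The peakedness order is preserved by convolution of symmetric unimodal laws, so the
weighted sum may be compared with a sum of such convolutions. The characteristic function of the
latter decays like `t⁻²` at scale `M / ‖α‖`, hence is integrable, and Parseval's identity against a
Gaussian of standard deviation `1 / s` gives the bound `M * s / ‖α‖` up to a constant.
-/

open Metric
open scoped ENNReal NNReal

/-- `F` is even and nonincreasing in `|x|`. -/
structure EvenUnimodal (F : ℝ → ℝ≥0∞) : Prop where
  measurable : Measurable F
  anti : ∀ ⦃x y : ℝ⦄, |x| ≤ |y| → F y ≤ F x

/-- `μ` is symmetric about `0` and unimodal, encoded by duality: averaging over the translates by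
`μ` preserves even unimodal functions. In this form closure under convolution is immediate. -/
def SymmUnimodal (μ : Measure ℝ) : Prop :=
  ∀ ⦃F : ℝ → ℝ≥0∞⦄, EvenUnimodal F → EvenUnimodal fun c => ∫⁻ y, F (c + y) ∂μ

/-- `μ` is less peaked around `0` than `ν` (Birnbaum's peakedness order): `ν` gives larger
integrals to even unimodal functions, in particular larger mass to the intervals `[-s, s]`. -/
def LessPeaked (μ ν : Measure ℝ) : Prop :=
  ∀ ⦃F : ℝ → ℝ≥0∞⦄, EvenUnimodal F → ∫⁻ x, F x ∂μ ≤ ∫⁻ x, F x ∂ν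

theorem mul_add_mul_le_mul_add_mul_of_canonicallyOrdered {R : Type*} [CommSemiring R]
    [PartialOrder R] [CanonicallyOrderedAdd R] {a b c d : R}
    (hab : a ≤ b) (hcd : c ≤ d) : a * d + b * c ≤ a * c + b * d := by
  obtain ⟨u, rfl⟩ := exists_add_of_le hab
  obtain ⟨v, rfl⟩ := exists_add_of_le hcd
  calc a * (c + v) + (a + u) * c = a * c + (a * (c + v) + u * c) := by ring
    _ ≤ a * c + (a * (c + v) + u * c) + u * v := le_self_add
    _ = a * c + (a + u) * (c + v) := by ring

theorem abs_translate_le_or_le {c c' : ℝ} (h : |c| ≤ |c'|) (y : ℝ) :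
    |c + y| ≤ |c' + y| ∧ |y| ≤ |c + c' + y| ∨ |c' + y| ≤ |c + y| ∧ |c + c' + y| ≤ |y| := by
  have hcc' : 0 ≤ (c' - c) * (c' + c) := by
    linear_combination sq_le_sq.2 h
  simp only [← sq_le_sq]
  -- Both `|c + y| ≤ |c' + y|` and `|y| ≤ |c + c' + y|` are decided by the sign of `c + c' + 2 * y`.
  rcases mul_nonneg_iff.1 hcc' with ⟨hd, hs⟩ | ⟨hd, hs⟩ <;>
  rcases le_total 0 (c + c' + 2 * y) with hy | hy
  · exact .inl ⟨by nlinarith, by nlinarith⟩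
  · exact .inr ⟨by nlinarith, by nlinarith⟩
  · exact .inr ⟨by nlinarith, by nlinarith⟩
  · exact .inl ⟨by nlinarith, by nlinarith⟩

namespace EvenUnimodal

variable {F G : ℝ → ℝ≥0∞}

theorem neg_eq (hF : EvenUnimodal F) (x : ℝ) : F (-x) = F x :=
  le_antisymm (hF.anti (abs_neg x).ge) (hF.anti (abs_neg x).le)

theorem const (k : ℝ≥0∞) : EvenUnimodal fun _ => k := ⟨measurable_const, fun _ _ _ => le_rfl⟩

theorem add (hF : EvenUnimodal F) (hG : EvenUnimodal G) : EvenUnimodal fun x => F x + G x :=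
  ⟨hF.measurable.add hG.measurable, fun _ _ h => add_le_add (hF.anti h) (hG.anti h)⟩

theorem const_mul (hF : EvenUnimodal F) (k : ℝ≥0∞) : EvenUnimodal fun x => k * F x :=
  ⟨hF.measurable.const_mul k, fun _ _ h => mul_le_mul_right (hF.anti h) k⟩

theorem comp_const_mul (hF : EvenUnimodal F) (r : ℝ) : EvenUnimodal fun x => F (r * x) :=
  ⟨hF.measurable.comp (measurable_const_mul r), fun x y h => hF.anti <| by
    simpa only [abs_mul] using mul_le_mul_of_nonneg_left h (abs_nonneg r)⟩

theorem indicator_closedBall (hF : EvenUnimodal F) (s : ℝ) :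
    EvenUnimodal ((closedBall 0 s).indicator F) where
  measurable := hF.measurable.indicator measurableSet_closedBall
  anti x y h := by
    refine Set.indicator_apply_le' (fun hy => ?_) fun _ => zero_le
    have hx : x ∈ closedBall 0 s := by
      rw [mem_closedBall_zero_iff, Real.norm_eq_abs] at hy ⊢
      exact h.trans hy
    rw [Set.indicator_of_mem hx]
    exact hF.anti h

theorem lintegral_translate_eq_reflect (hF : EvenUnimodal F) (hG : EvenUnimodal G) (c c' : ℝ) :
    ∫⁻ y, F (c + y) * G y = ∫⁻ y, F (c' + y) * G (c + c' + y) := by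
  rw [← lintegral_sub_left_eq_self _ (-(c + c'))]
  refine lintegral_congr fun y => ?_
  rw [← hF.neg_eq, ← hG.neg_eq]
  congr 2 <;> ring

theorem translate_exchange (hF : EvenUnimodal F) (hG : EvenUnimodal G) {c c' : ℝ}
    (h : |c| ≤ |c'|) (y : ℝ) :
    F (c' + y) * G y + F (c + y) * G (c + c' + y) ≤
      F (c + y) * G y + F (c' + y) * G (c + c' + y) := by
  rcases abs_translate_le_or_le h y with ⟨hc, hy⟩ | ⟨hc, hy⟩
  · rw [add_comm (F (c + y) * G y)]
    exact mul_add_mul_le_mul_add_mul_of_canonicallyOrdered (hF.anti hc) (hG.anti hy)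
  · rw [add_comm (F (c' + y) * G y)]
    exact mul_add_mul_le_mul_add_mul_of_canonicallyOrdered (hF.anti hc) (hG.anti hy)

theorem lintegral_translate_mul (hF : EvenUnimodal F) (hG : EvenUnimodal G) :
    EvenUnimodal fun c => ∫⁻ y, F (c + y) * G y where
  measurable := by
    have := hF.measurable
    have := hG.measurable
    fun_prop
  anti c c' h := by
    have hFm := hF.measurable
    have hGm := hG.measurable
    have hsum := lintegral_mono (μ := volume) (hF.translate_exchange hG h)
    rw [lintegral_add_left (by fun_prop), lintegral_add_left (by fun_prop),
      ← hF.lintegral_translate_eq_reflect hG c c', add_comm c c',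
      ← hF.lintegral_translate_eq_reflect hG c' c, ← two_mul, ← two_mul] at hsum
    exact (ENNReal.mul_le_mul_iff_right two_ne_zero ENNReal.ofNat_ne_top).1 hsum

end EvenUnimodal

namespace SymmUnimodal

variable {μ ν : Measure ℝ}

theorem dirac_zero : SymmUnimodal (Measure.dirac 0) := fun F hF => by
  simpa only [lintegral_dirac, add_zero] using hF

theorem add (hμ : SymmUnimodal μ) (hν : SymmUnimodal ν) : SymmUnimodal (μ + ν) := fun F hF => by
  simpa only [lintegral_add_measure] using (hμ hF).add (hν hF)

theorem smul (hμ : SymmUnimodal μ) (k : ℝ≥0∞) : SymmUnimodal (k • μ) := fun F hF => by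
  simpa only [lintegral_smul_measure, smul_eq_mul] using (hμ hF).const_mul k

theorem withDensity {G : ℝ → ℝ≥0∞} (hG : EvenUnimodal G) :
    SymmUnimodal (volume.withDensity G) := fun F hF => by
  have hdens (c : ℝ) : ∫⁻ y, F (c + y) ∂volume.withDensity G = ∫⁻ y, F (c + y) * G y := by
    have hFm := hF.measurable
    rw [lintegral_withDensity_eq_lintegral_mul _ hG.measurable (by fun_prop)]
    simp only [Pi.mul_apply, mul_comm (G _)]
  simpa only [hdens] using hF.lintegral_translate_mul hG

theorem withDensity_restrict {G : ℝ → ℝ≥0∞} (hG : EvenUnimodal G) (s : ℝ) :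
    SymmUnimodal ((volume.withDensity G).restrict (closedBall 0 s)) := by
  rw [MeasureTheory.restrict_withDensity measurableSet_closedBall,
    ← withDensity_indicator measurableSet_closedBall]
  exact withDensity (hG.indicator_closedBall s)

theorem withDensity_cond {G : ℝ → ℝ≥0∞} (hG : EvenUnimodal G) (s : ℝ) :
    SymmUnimodal (volume.withDensity G)[|closedBall 0 s] :=
  (withDensity_restrict hG s).smul _

theorem map_const_mul (hμ : SymmUnimodal μ) (r : ℝ) : SymmUnimodal (μ.map (r * ·)) := fun F hF => by
  have hFm := hF.measurable
  have hmap (c : ℝ) : ∫⁻ y, F (c + y) ∂μ.map (r * ·) = ∫⁻ y, F (c + r * y) ∂μ :=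
    lintegral_map (hFm.comp (measurable_const_add c)) (measurable_const_mul r)
  simp only [hmap]
  rcases eq_or_ne r 0 with rfl | hr
  · simpa only [zero_mul, add_zero, lintegral_const, mul_comm (F _)] using hF.const_mul _
  · have h := (hμ (hF.comp_const_mul r)).comp_const_mul r⁻¹
    simpa only [mul_add, mul_inv_cancel_left₀ hr] using h

theorem conv [SFinite ν] (hμ : SymmUnimodal μ) (hν : SymmUnimodal ν) :
    SymmUnimodal (μ ∗ ν) := fun F hF => by
  have hFm := hF.measurable
  have hconv (c : ℝ) : ∫⁻ y, F (c + y) ∂(μ ∗ ν) = ∫⁻ x, ∫⁻ y, F (c + x + y) ∂ν ∂μ := by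
    rw [Measure.lintegral_conv (by fun_prop)]
    simp only [add_assoc]
  simpa only [hconv] using hμ (hν hF)

end SymmUnimodal

namespace LessPeaked

variable {μ ν ρ : Measure ℝ}

theorem trans (h : LessPeaked μ ν) (h' : LessPeaked ν ρ) : LessPeaked μ ρ :=
  fun _ hF => (h hF).trans (h' hF)

theorem map_const_mul (h : LessPeaked μ ν) (r : ℝ) :
    LessPeaked (μ.map (r * ·)) (ν.map (r * ·)) := fun F hF => by
  rw [lintegral_map hF.measurable (measurable_const_mul r),
    lintegral_map hF.measurable (measurable_const_mul r)]
  exact h (hF.comp_const_mul r)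

theorem conv_left [SFinite ρ] (hρ : SymmUnimodal ρ) (h : LessPeaked μ ν) :
    LessPeaked (μ ∗ ρ) (ν ∗ ρ) := fun F hF => by
  rw [Measure.lintegral_conv hF.measurable, Measure.lintegral_conv hF.measurable]
  exact h (hρ hF)

theorem conv {μ' ν' : Measure ℝ} [SFinite ν] [SFinite μ'] [SFinite ν']
    (hν : SymmUnimodal ν) (hμ' : SymmUnimodal μ')
    (h : LessPeaked μ ν) (h' : LessPeaked μ' ν') : LessPeaked (μ ∗ μ') (ν ∗ ν') := by
  have hright : LessPeaked (ν ∗ μ') (ν ∗ ν') := by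
    rw [Measure.conv_comm ν, Measure.conv_comm ν]
    exact conv_left hν h'
  exact (conv_left hμ' h).trans hright

end LessPeaked

section Sum

variable {Ω Ω' ι : Type*} [MeasurableSpace Ω] [MeasurableSpace Ω'] {P : Measure Ω} {Q : Measure Ω'}
  {X : ι → Ω → ℝ} {Y : ι → Ω' → ℝ}

theorem map_const_mul_apply_eq_map_map {f : Ω → ℝ} (hf : Measurable f) (r : ℝ) :
    (P.map fun ω => r * f ω) = (P.map f).map (r * ·) :=
  (Measure.map_map (measurable_const_mul r) hf).symm

theorem measureReal_map_sum_closedBall (hX : ∀ i, Measurable (X i)) (s : Finset ι) (r : ℝ) :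
    (P.map (∑ i ∈ s, X i)).real (closedBall 0 r) = P.real {ω | |∑ i ∈ s, X i ω| ≤ r} := by
  rw [map_measureReal_apply (by fun_prop) measurableSet_closedBall]
  simp [Set.preimage, Finset.sum_apply]

theorem map_sum_insert_eq_conv [DecidableEq ι] (hX : ∀ i, Measurable (X i)) (hind : iIndepFun X P)
    {s : Finset ι} {i : ι} (hi : i ∉ s) :
    P.map (∑ j ∈ insert i s, X j) = P.map (X i) ∗ P.map (∑ j ∈ s, X j) := by
  have := hind.isProbabilityMeasure
  rw [Finset.sum_insert hi]
  exact (hind.indepFun_finsetSum_of_notMem hX hi).symm.map_add_eq_map_conv_map (hX i)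
    (by fun_prop)

theorem map_sum_empty_eq_dirac [IsProbabilityMeasure P] :
    P.map (∑ i ∈ ∅, X i) = Measure.dirac 0 := by
  rw [Finset.sum_empty, Pi.zero_def, Measure.map_const, measure_univ, one_smul]

theorem SymmUnimodal.map_finsetSum (hX : ∀ i, Measurable (X i)) (hind : iIndepFun X P)
    (hsu : ∀ i, SymmUnimodal (P.map (X i))) (s : Finset ι) :
    SymmUnimodal (P.map (∑ i ∈ s, X i)) := by
  classical
  have := hind.isProbabilityMeasure
  induction s using Finset.induction_on with
  | empty => exact map_sum_empty_eq_dirac (P := P) (X := X) ▸ dirac_zero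
  | insert i s hi ih => exact map_sum_insert_eq_conv hX hind hi ▸ (hsu i).conv ih

theorem LessPeaked.map_finsetSum (hX : ∀ i, Measurable (X i)) (hXind : iIndepFun X P)
    (hXsu : ∀ i, SymmUnimodal (P.map (X i))) (hY : ∀ i, Measurable (Y i)) (hYind : iIndepFun Y Q)
    (hYsu : ∀ i, SymmUnimodal (Q.map (Y i)))
    (hXY : ∀ i, LessPeaked (P.map (X i)) (Q.map (Y i))) (s : Finset ι) :
    LessPeaked (P.map (∑ i ∈ s, X i)) (Q.map (∑ i ∈ s, Y i)) := by
  classical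
  have := hXind.isProbabilityMeasure
  have := hYind.isProbabilityMeasure
  induction s using Finset.induction_on with
  | empty =>
    rw [map_sum_empty_eq_dirac, map_sum_empty_eq_dirac]
    exact fun _ _ => le_rfl
  | insert i s hi ih =>
    rw [map_sum_insert_eq_conv hX hXind hi, map_sum_insert_eq_conv hY hYind hi]
    exact conv (hYsu i) (.map_finsetSum hX hXind hXsu s) (hXY i) ih

theorem LessPeaked.map_sum_const_mul [Fintype ι] (hX : ∀ i, Measurable (X i))
    (hXind : iIndepFun X P) (hXsu : ∀ i, SymmUnimodal (P.map (X i)))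
    (hY : ∀ i, Measurable (Y i)) (hYind : iIndepFun Y Q)
    (hYsu : ∀ i, SymmUnimodal (Q.map (Y i)))
    (hXY : ∀ i, LessPeaked (P.map (X i)) (Q.map (Y i))) (α : ι → ℝ) :
    LessPeaked (P.map (∑ i, fun ω => α i * X i ω)) (Q.map (∑ i, fun ω => α i * Y i ω)) := by
  refine .map_finsetSum (fun i => (hX i).const_mul _)
    (hXind.comp (fun i x => α i * x) fun i => measurable_const_mul (α i)) (fun i => ?_)
    (fun i => (hY i).const_mul _)
    (hYind.comp (fun i x => α i * x) fun i => measurable_const_mul (α i)) (fun i => ?_)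
    (fun i => ?_) _
  · exact map_const_mul_apply_eq_map_map (P := P) (hX i) (α i) ▸ (hXsu i).map_const_mul (α i)
  · exact map_const_mul_apply_eq_map_map (P := Q) (hY i) (α i) ▸ (hYsu i).map_const_mul (α i)
  · rw [map_const_mul_apply_eq_map_map (hX i), map_const_mul_apply_eq_map_map (hY i)]
    exact (hXY i).map_const_mul (α i)

end Sum

section Uniform

variable {μ : Measure ℝ} {b : ℝ}

theorem LessPeaked.of_restrict_closedBall_le {κ : Measure ℝ} [IsProbabilityMeasure μ]
    [IsProbabilityMeasure κ] {r : ℝ} (hr : 0 ≤ r) (hκ : ∀ᵐ x ∂κ, x ∈ closedBall 0 r)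
    (hle : μ.restrict (closedBall 0 r) ≤ κ) : LessPeaked μ κ := fun F hF => by
  set B : Set ℝ := closedBall 0 r
  have hB : MeasurableSet B := measurableSet_closedBall
  set ν := κ - μ.restrict B
  have hsplit : ν + μ.restrict B = κ := Measure.sub_add_cancel_of_le hle
  have hmass : μ Bᶜ = ν Set.univ := by
    refine (ENNReal.add_left_inj (measure_ne_top μ B)).1 ?_
    have hκ1 := congrArg (· Set.univ) hsplit
    simp only [Measure.add_apply, Measure.restrict_apply_univ, measure_univ] at hκ1
    rw [add_comm, measure_add_measure_compl hB, measure_univ, hκ1]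
  have houter : ∫⁻ x in Bᶜ, F x ∂μ ≤ F r * μ Bᶜ := by
    rw [← setLIntegral_const]
    refine setLIntegral_mono measurable_const fun x hx => hF.anti ?_
    rw [Set.mem_compl_iff, mem_closedBall_zero_iff, Real.norm_eq_abs, not_le] at hx
    rw [abs_of_nonneg hr]
    exact hx.le
  have hinner : F r * ν Set.univ ≤ ∫⁻ x, F x ∂ν := by
    rw [← lintegral_const]
    refine lintegral_mono_ae ?_
    filter_upwards [(Measure.absolutelyContinuous_of_le Measure.sub_le).ae_le hκ] with x hx
    refine hF.anti ?_
    rw [mem_closedBall_zero_iff, Real.norm_eq_abs] at hx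
    exact hx.trans (le_abs_self r)
  calc ∫⁻ x, F x ∂μ = ∫⁻ x in Bᶜ, F x ∂μ + ∫⁻ x in B, F x ∂μ := by
        rw [add_comm, lintegral_add_compl F hB]
    _ ≤ ∫⁻ x, F x ∂ν + ∫⁻ x in B, F x ∂μ :=
        add_le_add_left (houter.trans (hmass ▸ hinner)) _
    _ = ∫⁻ x, F x ∂κ := by rw [← lintegral_add_measure, hsplit]

/-- The uniform distribution on `[-b, b]`. -/
noncomputable def symmUniform (b : ℝ) : Measure ℝ := volume[|closedBall 0 b]

theorem symmUniform_eq_smul_restrict (b : ℝ) :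
    symmUniform b = (ENNReal.ofReal (2 * b))⁻¹ • volume.restrict (closedBall 0 b) := by
  rw [symmUniform, ProbabilityTheory.cond, Real.volume_closedBall]

theorem lintegral_symmUniform (b : ℝ) (F : ℝ → ℝ≥0∞) :
    ∫⁻ x, F x ∂symmUniform b = (ENNReal.ofReal (2 * b))⁻¹ * ∫⁻ x in closedBall 0 b, F x := by
  rw [symmUniform_eq_smul_restrict, lintegral_smul_measure, smul_eq_mul]

theorem isProbabilityMeasure_symmUniform (hb : 0 < b) : IsProbabilityMeasure (symmUniform b) :=
  cond_isProbabilityMeasure_of_finite (by simpa) measure_closedBall_lt_top.ne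

theorem symmUnimodal_symmUniform (b : ℝ) : SymmUnimodal (symmUniform b) := by
  have h := SymmUnimodal.withDensity_cond (.const 1) b
  rwa [← Pi.one_def, withDensity_one] at h

theorem LessPeaked.symmUniform_of_le_smul_volume [IsProbabilityMeasure μ] (hb : 0 < b)
    (hμ : μ ≤ (ENNReal.ofReal (2 * b))⁻¹ • volume) : LessPeaked μ (symmUniform b) := by
  have := isProbabilityMeasure_symmUniform hb
  refine .of_restrict_closedBall_le hb.le (ae_cond_mem measurableSet_closedBall) ?_
  rw [symmUniform_eq_smul_restrict, ← Measure.restrict_smul]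
  exact Measure.restrict_mono_measure hμ _

theorem setLIntegral_closedBall_eq_lintegral_symmUniform (hb : 0 < b) (F : ℝ → ℝ≥0∞) (c : ℝ) :
    ∫⁻ x in closedBall c b, F x = ENNReal.ofReal (2 * b) * ∫⁻ y, F (c + y) ∂symmUniform b := by
  have htranslate := (measurePreserving_add_left volume c).setLIntegral_comp_preimage_emb
    (measurableEmbedding_addLeft c) F (closedBall c b)
  rw [preimage_add_left_closedBall, neg_add_cancel] at htranslate
  rw [lintegral_symmUniform, ENNReal.mul_inv_cancel_left (by simpa) ENNReal.ofReal_ne_top,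
    htranslate]

theorem LessPeaked.symmUniform_two_mul_conv (hb : 0 < b) :
    LessPeaked (symmUniform (2 * b)) (symmUniform b ∗ symmUniform b) := fun F hF => by
  have := isProbabilityMeasure_symmUniform hb
  set G : ℝ → ℝ≥0∞ := fun c => ∫⁻ y, F (c + y) ∂symmUniform b
  have hGeven : EvenUnimodal G := symmUnimodal_symmUniform b hF
  have hcover : closedBall 0 (2 * b) ⊆ closedBall b b ∪ closedBall (-b) b := fun x hx => by
    simp only [Real.closedBall_eq_Icc, Set.mem_union, Set.mem_Icc] at hx ⊢
    grind
  have hhalves : ∫⁻ x, F x ∂symmUniform (2 * b) ≤ G b := by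
    calc ∫⁻ x, F x ∂symmUniform (2 * b)
        ≤ (ENNReal.ofReal (2 * (2 * b)))⁻¹ *
            ((∫⁻ x in closedBall b b, F x) + ∫⁻ x in closedBall (-b) b, F x) := by
          rw [lintegral_symmUniform]
          gcongr
          exact (lintegral_mono_set hcover).trans (lintegral_union_le _ _ _)
      _ = (ENNReal.ofReal (2 * (2 * b)))⁻¹ * (ENNReal.ofReal (2 * (2 * b)) * G b) := by
          rw [setLIntegral_closedBall_eq_lintegral_symmUniform hb,
            setLIntegral_closedBall_eq_lintegral_symmUniform hb]
          change _ * (_ * G b + _ * G (-b)) = _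
          rw [hGeven.neg_eq, ← two_mul, ENNReal.ofReal_mul zero_le_two, ENNReal.ofReal_ofNat,
            mul_assoc 2]
      _ = G b := ENNReal.inv_mul_cancel_left (by simpa) ENNReal.ofReal_ne_top
  calc ∫⁻ x, F x ∂symmUniform (2 * b) ≤ ∫⁻ _, G b ∂symmUniform b := by simpa using hhalves
    _ ≤ ∫⁻ x, G x ∂symmUniform b := by
        refine lintegral_mono_ae ?_
        filter_upwards [ae_cond_mem measurableSet_closedBall] with x hx
        rw [mem_closedBall_zero_iff, Real.norm_eq_abs] at hx
        exact hGeven.anti (hx.trans (le_abs_self b))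
    _ = ∫⁻ x, F x ∂(symmUniform b ∗ symmUniform b) := (Measure.lintegral_conv hF.measurable).symm

theorem LessPeaked.symmUniform_conv_of_le_smul_volume [IsProbabilityMeasure μ] (hb : 0 < b)
    (hμ : μ ≤ (ENNReal.ofReal (4 * b))⁻¹ • volume) :
    LessPeaked μ (symmUniform b ∗ symmUniform b) := by
  rw [show 4 * b = 2 * (2 * b) by ring] at hμ
  exact (symmUniform_of_le_smul_volume (mul_pos two_pos hb) hμ).trans (symmUniform_two_mul_conv hb)

end Uniform

section Concentration

variable {μ : Measure ℝ} {r s σ : ℝ}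

theorem SymmUnimodal.measure_closedBall_le (hμ : SymmUnimodal μ) (c s : ℝ) :
    μ (closedBall c s) ≤ μ (closedBall 0 s) := by
  have hball : EvenUnimodal ((closedBall 0 s).indicator 1) :=
    (EvenUnimodal.const 1).indicator_closedBall s
  have htranslate (c : ℝ) :
      ∫⁻ y, (closedBall 0 s).indicator 1 (-c + y) ∂μ = μ (closedBall c s) := by
    rw [← lintegral_indicator_one measurableSet_closedBall]
    refine lintegral_congr fun y => ?_
    simp only [Set.indicator, mem_closedBall, dist_zero_right, Real.dist_eq,
      Real.norm_eq_abs, neg_add_eq_sub, Pi.one_apply]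
  have h := (hμ hball).anti (x := -0) (y := -c) (by simp)
  rwa [htranslate, htranslate] at h

theorem SymmUnimodal.measureReal_closedBall_le_mul [IsFiniteMeasure μ] (hμ : SymmUnimodal μ)
    (s : ℝ) (N : ℕ) (c : ℝ) :
    μ.real (closedBall c ((N + 1) * s)) ≤ (N + 1) * μ.real (closedBall 0 s) := by
  have hmax (c : ℝ) : μ.real (closedBall c s) ≤ μ.real (closedBall 0 s) :=
    ENNReal.toReal_mono (measure_ne_top _ _) (hμ.measure_closedBall_le c s)
  induction N generalizing c with
  | zero => simpa using hmax c
  | succ N ih =>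
    have hcover : closedBall c ((N + 1 + 1) * s) ⊆
        closedBall (c - s) ((N + 1) * s) ∪ closedBall (c + (N + 1) * s) s := fun x hx => by
      simp only [Real.closedBall_eq_Icc, Set.mem_union, Set.mem_Icc] at hx ⊢
      grind
    push_cast
    calc μ.real (closedBall c ((N + 1 + 1) * s))
        ≤ μ.real (closedBall (c - s) ((N + 1) * s)) +
            μ.real (closedBall (c + (N + 1) * s) s) :=
          (measureReal_mono hcover).trans (measureReal_union_le _ _)
      _ ≤ (N + 1) * μ.real (closedBall 0 s) + μ.real (closedBall 0 s) :=
          add_le_add (ih _) (hmax _)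
      _ = (N + 1 + 1) * μ.real (closedBall 0 s) := by ring

theorem one_sub_variance_div_sq_le_measureReal_closedBall [IsProbabilityMeasure μ]
    (hμ : MemLp id 2 μ) (hr : 0 < r) :
    1 - Var[id; μ] / r ^ 2 ≤ μ.real (closedBall μ[id] r) := by
  have hcheb : μ.real {x | r ≤ |x - μ[id]|} ≤ Var[id; μ] / r ^ 2 :=
    ENNReal.toReal_le_of_le_ofReal (div_nonneg (variance_nonneg _ _) (sq_nonneg r))
      (meas_ge_le_variance_div_sq hμ hr)
  have hcompl : μ.real (closedBall μ[id] r)ᶜ ≤ μ.real {x | r ≤ |x - μ[id]|} :=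
    measureReal_mono fun x hx => by
      rw [Set.mem_compl_iff, mem_closedBall, Real.dist_eq, not_le] at hx
      exact hx.le
  rw [probReal_compl_eq_one_sub measurableSet_closedBall] at hcompl
  linarith

theorem SymmUnimodal.le_measureReal_closedBall [IsProbabilityMeasure μ] (hμ : SymmUnimodal μ)
    (hLp : MemLp id 2 μ) (hvar : Var[id; μ] ≤ σ ^ 2) (hs : 0 < s) (hsσ : s ≤ σ) :
    s / (4 * σ) ≤ μ.real (closedBall 0 s) := by
  have hσ : 0 < σ := hs.trans_le hsσ
  set N := ⌊2 * σ / s⌋₊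
  have hN : 2 * σ < (N + 1) * s := (div_lt_iff₀ hs).1 (Nat.lt_floor_add_one _)
  have hN' : (N + 1) * s ≤ 3 * σ := by
    have := (le_div_iff₀ hs).1 (Nat.floor_le (by positivity : 0 ≤ 2 * σ / s))
    linarith
  have hmass : 3 / 4 ≤ μ.real (closedBall μ[id] ((N + 1) * s)) := by
    have hcheb := one_sub_variance_div_sq_le_measureReal_closedBall hLp (mul_pos two_pos hσ)
    have hquarter : Var[id; μ] / (2 * σ) ^ 2 ≤ 1 / 4 := by
      rw [div_le_iff₀ (by positivity)]
      linarith
    have hmono := measureReal_mono (μ := μ) (closedBall_subset_closedBall (x := μ[id]) hN.le)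
    linarith
  have hcover := hμ.measureReal_closedBall_le_mul s N μ[id]
  rw [div_le_iff₀ (by positivity)]
  have hpigeonhole : 3 / 4 * s ≤ 3 * σ * μ.real (closedBall 0 s) := by
    calc 3 / 4 * s ≤ (N + 1) * μ.real (closedBall 0 s) * s :=
          mul_le_mul_of_nonneg_right (hmass.trans hcover) hs.le
      _ = (N + 1) * s * μ.real (closedBall 0 s) := by ring
      _ ≤ 3 * σ * μ.real (closedBall 0 s) := by gcongr
  linarith

theorem le_measureReal_abs_sum_le {Ω ι : Type*} [MeasurableSpace Ω] {P : Measure Ω} [Fintype ι]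
    {X : ι → Ω → ℝ} (hX : ∀ i, Measurable (X i)) (hind : iIndepFun X P)
    (hsu : ∀ i, SymmUnimodal (P.map (X i))) (hLp : ∀ i, MemLp (X i) 2 P)
    (hvar : ∑ i, Var[X i; P] ≤ σ ^ 2) (hs : 0 < s) (hsσ : s ≤ σ) :
    s / (4 * σ) ≤ P.real {ω | |∑ i, X i ω| ≤ s} := by
  have := hind.isProbabilityMeasure
  have hsum : Measurable (∑ i, X i) := by fun_prop
  have := Measure.isProbabilityMeasure_map (μ := P) hsum.aemeasurable
  have hsuSum := SymmUnimodal.map_finsetSum hX hind hsu Finset.univ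
  have hLpSum : MemLp id 2 (P.map (∑ i, X i)) :=
    (memLp_map_measure_iff (by fun_prop) hsum.aemeasurable).2 (memLp_finsetSum' _ fun i _ => hLp i)
  have hvarSum : Var[id; P.map (∑ i, X i)] ≤ σ ^ 2 := by
    rw [variance_id_map hsum.aemeasurable, IndepFun.variance_sum (fun i _ => hLp i)
      fun i _ j _ hij => hind.indepFun hij]
    exact hvar
  have h := hsuSum.le_measureReal_closedBall hLpSum hvarSum hs hsσ
  rwa [measureReal_map_sum_closedBall hX] at h

end Concentration

section Truncation

variable {a : ℝ}

theorem evenUnimodal_gaussianPDF (v : ℝ≥0) : EvenUnimodal (gaussianPDF 0 v) := by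
  refine ⟨measurable_gaussianPDF 0 v, fun x y h => ?_⟩
  have := sq_le_sq.2 h
  simp only [gaussianPDF, gaussianPDFReal, sub_zero]
  gcongr ENNReal.ofReal (_ * Real.exp (-?_ / _))

theorem measurable_trunc (a : ℝ) : Measurable (trunc a) :=
  Measurable.ite (measurableSet_le (by fun_prop) (by fun_prop)) measurable_id measurable_const

theorem trunc_of_mem {x : ℝ} (hx : x ∈ closedBall 0 a) : trunc a x = x :=
  if_pos (mem_closedBall_zero_iff.1 hx)

theorem trunc_of_notMem {x : ℝ} (hx : x ∉ closedBall 0 a) : trunc a x = 0 :=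
  if_neg (mt mem_closedBall_zero_iff.2 hx)

theorem abs_trunc_le (ha : 0 ≤ a) (x : ℝ) : |trunc a x| ≤ a := by
  unfold trunc
  split_ifs with h
  · exact h
  · rwa [abs_zero]

theorem abs_trunc_le_abs (a x : ℝ) : |trunc a x| ≤ |x| := by
  unfold trunc
  split_ifs <;> simp

theorem map_trunc_eq (μ : Measure ℝ) (a : ℝ) :
    μ.map (trunc a) = μ.restrict (closedBall 0 a) + μ (closedBall 0 a)ᶜ • Measure.dirac 0 := by
  have hB : MeasurableSet (closedBall (0 : ℝ) a) := measurableSet_closedBall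
  have hin : (μ.restrict (closedBall 0 a)).map (trunc a) = μ.restrict (closedBall 0 a) := by
    conv_rhs => rw [← Measure.map_id (μ := μ.restrict (closedBall 0 a))]
    refine Measure.map_congr ?_
    filter_upwards [ae_restrict_mem hB] with x hx using trunc_of_mem hx
  have hout : (μ.restrict (closedBall 0 a)ᶜ).map (trunc a) =
      μ (closedBall 0 a)ᶜ • Measure.dirac 0 := by
    rw [← Measure.restrict_apply_univ, ← Measure.map_const]
    refine Measure.map_congr ?_
    filter_upwards [ae_restrict_mem hB.compl] with x hx using trunc_of_notMem hx
  conv_lhs => rw [← Measure.restrict_add_restrict_compl (μ := μ) hB]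
  rw [Measure.map_add _ _ (measurable_trunc a), hin, hout]

theorem symmUnimodal_gaussianReal_map_trunc {v : ℝ≥0} (hv : v ≠ 0) (a : ℝ) :
    SymmUnimodal ((gaussianReal 0 v).map (trunc a)) := by
  rw [map_trunc_eq, gaussianReal_of_var_ne_zero 0 hv]
  exact (SymmUnimodal.withDensity_restrict (evenUnimodal_gaussianPDF v) a).add
    (SymmUnimodal.dirac_zero.smul _)

theorem memLp_trunc (μ : Measure ℝ) [IsFiniteMeasure μ] (p : ℝ≥0∞) (ha : 0 ≤ a) :
    MemLp (trunc a) p μ :=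
  MemLp.of_bound (measurable_trunc a).aestronglyMeasurable a (.of_forall (abs_trunc_le ha))

theorem variance_trunc_le_sq (μ : Measure ℝ) [IsProbabilityMeasure μ] (ha : 0 ≤ a) :
    Var[trunc a; μ] ≤ a ^ 2 := by
  calc Var[trunc a; μ] ≤ ∫ x, trunc a x ^ 2 ∂μ :=
        variance_le_expectation_sq (measurable_trunc a).aestronglyMeasurable
    _ ≤ ∫ _, a ^ 2 ∂μ :=
        integral_mono (memLp_trunc μ 2 ha).integrable_sq (integrable_const _) fun x =>
          sq_le_sq.2 ((abs_trunc_le ha x).trans (le_abs_self a))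
    _ = a ^ 2 := by simp

theorem variance_gaussianReal_trunc_le (v : ℝ≥0) (ha : 0 ≤ a) :
    Var[trunc a; gaussianReal 0 v] ≤ v := by
  have hid : MemLp id 2 (gaussianReal 0 v) := memLp_id_gaussianReal 2
  calc Var[trunc a; gaussianReal 0 v] ≤ ∫ x, trunc a x ^ 2 ∂gaussianReal 0 v :=
        variance_le_expectation_sq (measurable_trunc a).aestronglyMeasurable
    _ ≤ ∫ x, id x ^ 2 ∂gaussianReal 0 v :=
        integral_mono (memLp_trunc _ 2 ha).integrable_sq hid.integrable_sq fun x =>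
          sq_le_sq.2 (abs_trunc_le_abs a x)
    _ = Var[id; gaussianReal 0 v] :=
        (variance_of_integral_eq_zero aemeasurable_id integral_id_gaussianReal).symm
    _ = v := variance_id_gaussianReal

theorem variance_trunc_le_sq_min (ha : 0 ≤ a) :
    Var[trunc a; gaussianReal 0 1] ≤ (10 * min a (1 / 10)) ^ 2 := by
  rcases min_choice a (1 / 10) with h | h <;> rw [h]
  · nlinarith [variance_trunc_le_sq (gaussianReal 0 1) ha]
  · simpa using variance_gaussianReal_trunc_le 1 ha

theorem le_measureReal_smallBall {n : ℕ} (α : EuclideanSpace ℝ (Fin n)) {δ : ℝ} (ha : 0 < a)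
    (hδ : 0 < δ) (hδ1 : δ ≤ 1) :
    1 / 40 * δ ≤ (stdGaussianLaw n).real (smallBall α a δ) := by
  rcases eq_or_ne α 0 with rfl | hα
  · have hall : smallBall (0 : EuclideanSpace ℝ (Fin n)) a δ = Set.univ := by
      simp [smallBall, linForm]
    rw [hall, stdGaussianLaw, probReal_univ]
    linarith
  set m := min a (1 / 10)
  have hm0 : 0 < m := lt_min ha (by norm_num)
  have : 0 < ‖α‖ := norm_pos_iff.2 hα
  have htm := measurable_trunc a
  have heval (i) : MeasurePreserving (fun x : Fin n → ℝ => x i) (stdGaussianLaw n)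
      (gaussianReal 0 1) := measurePreserving_eval _ i
  have hind : iIndepFun (fun i x => α i * trunc a (x i)) (stdGaussianLaw n) :=
    iIndepFun_pi (X := fun i x => α i * trunc a x) fun i => by fun_prop
  have hsu (i) : SymmUnimodal ((stdGaussianLaw n).map fun x => α i * trunc a (x i)) := by
    have h := (symmUnimodal_gaussianReal_map_trunc one_ne_zero a).map_const_mul (α i)
    rwa [← (heval i).map_eq, Measure.map_map htm (heval i).measurable,
      ← map_const_mul_apply_eq_map_map (by fun_prop)] at h
  have hLp (i) : MemLp (fun x : Fin n → ℝ => α i * trunc a (x i)) 2 (stdGaussianLaw n) :=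
    ((memLp_trunc _ 2 ha.le).const_mul (α i)).comp_measurePreserving (heval i)
  have hvar : ∑ i, Var[fun x : Fin n → ℝ => α i * trunc a (x i); stdGaussianLaw n] ≤
      (10 * m * ‖α‖) ^ 2 := by
    rw [mul_pow, EuclideanSpace.norm_sq_eq, Finset.mul_sum]
    refine Finset.sum_le_sum fun i _ => ?_
    rw [variance_const_mul, (heval i).variance_fun_comp htm.aemeasurable, mul_comm,
      Real.norm_eq_abs, sq_abs]
    gcongr
    exact variance_trunc_le_sq_min ha.le
  calc 1 / 40 * δ = m * δ * ‖α‖ / (4 * (10 * m * ‖α‖)) := by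
        field_simp
        norm_num
    _ ≤ _ := le_measureReal_abs_sum_le (fun i => by fun_prop) hind hsu hLp hvar (by positivity)
        (mul_le_mul_of_nonneg_right (by nlinarith) (norm_nonneg _))

end Truncation

section CharFun

theorem charFun_symmUniform {b : ℝ} (hb : 0 < b) (t : ℝ) :
    charFun (symmUniform b) t = Real.sinc (t * b) := by
  have hinterval :
      ∫ x : ℝ in -b..b, Complex.exp (t * x * Complex.I) = 2 * b * Real.sinc (t * b) := by
    rcases eq_or_ne t 0 with rfl | ht
    · simp [two_mul]
    · have h := intervalIntegral.integral_comp_mul_left (a := -b) (b := b)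
        (fun x : ℝ => Complex.exp (x * Complex.I)) ht
      rw [mul_neg, integral_exp_mul_I_eq_sinc] at h
      push_cast at h
      rw [h, Complex.real_smul]
      push_cast
      have : (t : ℂ) ≠ 0 := Complex.ofReal_ne_zero.2 ht
      field_simp
  have : (b : ℂ) ≠ 0 := Complex.ofReal_ne_zero.2 hb.ne'
  rw [charFun_apply_real, symmUniform_eq_smul_restrict, integral_smul_measure,
    Real.closedBall_eq_Icc, zero_sub, zero_add, integral_Icc_eq_integral_Ioc,
    ← intervalIntegral.integral_of_le (by linarith), hinterval, ENNReal.toReal_inv,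
    ENNReal.toReal_ofReal (by positivity), Complex.real_smul]
  push_cast
  field_simp

theorem sin_sq_mul_le (y : ℝ) : Real.sin y ^ 2 * (1 + y ^ 2 / 4) ≤ y ^ 2 := by
  rcases le_or_gt |y| 2 with hy | hy
  · obtain ⟨hy1, hy2⟩ := abs_le.1 hy
    have hpi := Real.pi_gt_three
    have hcos0 : 0 ≤ Real.cos (y / 2) :=
      Real.cos_nonneg_of_neg_pi_div_two_le_of_le (by linarith) (by linarith)
    have hcos : Real.cos (y / 2) ^ 2 * (1 + y ^ 2 / 4) ≤ 1 := by
      have h := pow_le_pow_left₀ hcos0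
        (Real.cos_le_one_div_sqrt_sq_add_one (x := y / 2) (by linarith) (by linarith)) 2
      rw [div_pow, Real.sq_sqrt (by positivity), one_pow, le_div_iff₀ (by positivity)] at h
      linarith
    have hdouble : Real.sin y = 2 * Real.sin (y / 2) * Real.cos (y / 2) := by
      rw [← Real.sin_two_mul, mul_div_cancel₀ y two_ne_zero]
    calc Real.sin y ^ 2 * (1 + y ^ 2 / 4)
        = 4 * Real.sin (y / 2) ^ 2 * (Real.cos (y / 2) ^ 2 * (1 + y ^ 2 / 4)) := by
          rw [hdouble]; ring
      _ ≤ 4 * (y / 2) ^ 2 * 1 := by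
          gcongr ?_ * ?_
          exact mul_le_mul_of_nonneg_left (sq_le_sq.2 Real.abs_sin_le_abs) zero_le_four
      _ = y ^ 2 := by ring
  · have hy4 : 4 < y ^ 2 := by
      rw [← sq_abs]
      nlinarith
    nlinarith [Real.sin_sq_le_one y]

theorem sinc_sq_le (y : ℝ) : Real.sinc y ^ 2 ≤ (1 + y ^ 2 / 4)⁻¹ := by
  rcases eq_or_ne y 0 with rfl | hy
  · simp
  · rw [Real.sinc_of_ne_zero hy, div_pow, div_le_iff₀ (by positivity), ← div_eq_inv_mul,
      le_div_iff₀ (by positivity)]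
    exact sin_sq_mul_le y

theorem norm_charFun_symmUniform_conv_le {b : ℝ} (hb : 0 < b) (t : ℝ) :
    ‖charFun (symmUniform b ∗ symmUniform b) t‖ ≤ (1 + (b / 2 * t) ^ 2)⁻¹ := by
  have := isProbabilityMeasure_symmUniform hb
  rw [charFun_conv, charFun_symmUniform hb, ← sq, norm_pow, Complex.norm_real, Real.norm_eq_abs,
    sq_abs]
  convert sinc_sq_le (t * b) using 3
  ring

theorem integral_charFun_comm (μ ν : Measure ℝ) [IsFiniteMeasure μ] [IsFiniteMeasure ν] :
    ∫ x, charFun μ x ∂ν = ∫ x, charFun ν x ∂μ := by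
  simp only [charFun_apply_real]
  rw [integral_integral_swap]
  · simp only [mul_comm]
  · refine Integrable.of_bound (C := 1) ?_ (.of_forall fun p => ?_)
    · exact Measurable.aestronglyMeasurable (by unfold Function.uncurry; fun_prop)
    · rw [Function.uncurry, ← Complex.ofReal_mul, Complex.norm_exp_ofReal_mul_I]

theorem one_add_sum_le_prod_one_add {ι : Type*} (s : Finset ι) {f : ι → ℝ} (hf : ∀ i, 0 ≤ f i) :
    1 + ∑ i ∈ s, f i ≤ ∏ i ∈ s, (1 + f i) := by
  classical
  induction s using Finset.induction_on with
  | empty => simp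
  | insert i s hi ih =>
    rw [Finset.sum_insert hi, Finset.prod_insert hi]
    calc 1 + (f i + ∑ j ∈ s, f j)
        ≤ (1 + f i) * (1 + ∑ j ∈ s, f j) := by
          linarith [mul_nonneg (hf i) (s.sum_nonneg fun j _ => hf j)]
      _ ≤ (1 + f i) * ∏ j ∈ s, (1 + f j) :=
          mul_le_mul_of_nonneg_left ih (add_nonneg zero_le_one (hf i))

theorem norm_charFun_map_sum_const_mul_le {Ω ι : Type*} [MeasurableSpace Ω] [Fintype ι]
    {P : Measure Ω} {X : ι → Ω → ℝ} {w : ℝ} (hX : ∀ i, Measurable (X i)) (hind : iIndepFun X P)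
    (hchar : ∀ i t, ‖charFun (P.map (X i)) t‖ ≤ (1 + (w * t) ^ 2)⁻¹)
    (α : EuclideanSpace ℝ ι) (t : ℝ) :
    ‖charFun (P.map (∑ i, fun ω => α i * X i ω)) t‖ ≤ (1 + (w * ‖α‖ * t) ^ 2)⁻¹ := by
  have hind' : iIndepFun (fun i ω => α i * X i ω) P :=
    hind.comp (fun i x => α i * x) fun i => measurable_const_mul (α i)
  have hfactor (i : ι) : ‖charFun (P.map fun ω => α i * X i ω) t‖ ≤
      (1 + (w * (α i * t)) ^ 2)⁻¹ := by
    rw [map_const_mul_apply_eq_map_map (hX i), charFun_map_mul]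
    exact hchar i _
  rw [hind'.charFun_map_sum_eq_prod fun i => ((hX i).const_mul (α i)).aemeasurable,
    Finset.prod_apply, norm_prod]
  calc ∏ i, ‖charFun (P.map fun ω => α i * X i ω) t‖
      ≤ ∏ i, (1 + (w * (α i * t)) ^ 2)⁻¹ :=
        Finset.prod_le_prod (fun i _ => norm_nonneg _) fun i _ => hfactor i
    _ = (∏ i, (1 + (w * (α i * t)) ^ 2))⁻¹ := Finset.prod_inv_distrib _
    _ ≤ (1 + ∑ i, (w * (α i * t)) ^ 2)⁻¹ := by
        gcongr
        exact one_add_sum_le_prod_one_add _ fun i => sq_nonneg _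
    _ = (1 + (w * ‖α‖ * t) ^ 2)⁻¹ := by
        simp only [mul_pow, EuclideanSpace.norm_sq_eq, Real.norm_eq_abs, sq_abs, Finset.mul_sum,
          Finset.sum_mul, mul_assoc]

end CharFun

section AntiConcentration

variable {σ μ : Measure ℝ} {v s : ℝ}

theorem gaussianPDFReal_le_inv_sqrt (m : ℝ) (w : ℝ≥0) (x : ℝ) :
    gaussianPDFReal m w x ≤ (√(2 * Real.pi * w))⁻¹ := by
  refine mul_le_of_le_one_right (by positivity) (Real.exp_le_one_iff.2 ?_)
  rw [neg_div, neg_nonpos]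
  positivity

theorem integral_gaussianReal_inv_one_add_sq_le (m : ℝ) {w : ℝ≥0} (hw : w ≠ 0) (hv : 0 < v) :
    ∫ t, (1 + (v * t) ^ 2)⁻¹ ∂gaussianReal m w ≤ Real.pi / (v * √(2 * Real.pi * w)) := by
  have hint : Integrable fun t : ℝ => (√(2 * Real.pi * w))⁻¹ * (1 + (v * t) ^ 2)⁻¹ :=
    (integrable_inv_one_add_sq.comp_mul_left' hv.ne').const_mul _
  rw [integral_gaussianReal_eq_integral_smul hw]
  calc ∫ t, gaussianPDFReal m w t • (1 + (v * t) ^ 2)⁻¹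
      ≤ ∫ t, (√(2 * Real.pi * w))⁻¹ * (1 + (v * t) ^ 2)⁻¹ := by
        refine integral_mono_of_nonneg (.of_forall fun t => ?_) hint (.of_forall fun t => ?_)
        · exact mul_nonneg (gaussianPDFReal_nonneg _ _ _) (by positivity)
        · exact mul_le_mul_of_nonneg_right (gaussianPDFReal_le_inv_sqrt m w t) (by positivity)
    _ = Real.pi / (v * √(2 * Real.pi * w)) := by
        rw [integral_const_mul, Measure.integral_comp_mul_left (fun t => (1 + t ^ 2)⁻¹),
          integral_univ_inv_one_add_sq, abs_of_pos (inv_pos.2 hv), smul_eq_mul]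
        field_simp

theorem integral_exp_neg_sq_le_of_norm_charFun_le [IsProbabilityMeasure σ]
    (hv : 0 < v) (hσ : ∀ t, ‖charFun σ t‖ ≤ (1 + (v * t) ^ 2)⁻¹) {w : ℝ≥0} (hw : w ≠ 0) :
    ∫ y, Real.exp (-(w * y ^ 2 / 2)) ∂σ ≤ Real.pi / (v * √(2 * Real.pi * w)) := by
  have hparseval : ((∫ y, Real.exp (-(w * y ^ 2 / 2)) ∂σ : ℝ) : ℂ) =
      ∫ t, charFun σ t ∂gaussianReal 0 w := by
    rw [integral_charFun_comm, ← integral_complex_ofReal]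
    simp [charFun_gaussianReal]
  have hint : Integrable (fun t : ℝ => (1 + (v * t) ^ 2)⁻¹) (gaussianReal 0 w) := by
    refine Integrable.of_bound (C := 1) (by fun_prop) (.of_forall fun t => ?_)
    rw [Real.norm_of_nonneg (by positivity)]
    exact inv_le_one_of_one_le₀ (le_add_of_nonneg_right (sq_nonneg _))
  calc ∫ y, Real.exp (-(w * y ^ 2 / 2)) ∂σ
      ≤ ‖∫ t, charFun σ t ∂gaussianReal 0 w‖ := by
        rw [← hparseval, Complex.norm_real]
        exact Real.le_norm_self _
    _ ≤ ∫ t, (1 + (v * t) ^ 2)⁻¹ ∂gaussianReal 0 w :=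
        norm_integral_le_of_norm_le hint (.of_forall hσ)
    _ ≤ _ := integral_gaussianReal_inv_one_add_sq_le 0 hw hv

theorem evenUnimodal_exp_neg_sq (w : ℝ≥0) :
    EvenUnimodal fun y => ENNReal.ofReal (Real.exp (-(w * y ^ 2 / 2))) := by
  refine ⟨by fun_prop, fun x y h => ?_⟩
  have := sq_le_sq.2 h
  gcongr

theorem LessPeaked.integral_le (h : LessPeaked μ σ) {f : ℝ → ℝ}
    (hf : EvenUnimodal fun y => ENNReal.ofReal (f y)) (hf0 : ∀ y, 0 ≤ f y)
    (hμ : Integrable f μ) (hσ : Integrable f σ) : ∫ y, f y ∂μ ≤ ∫ y, f y ∂σ := by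
  refine (ENNReal.ofReal_le_ofReal_iff (integral_nonneg hf0)).1 ?_
  rw [ofReal_integral_eq_lintegral_ofReal hμ (.of_forall hf0),
    ofReal_integral_eq_lintegral_ofReal hσ (.of_forall hf0)]
  exact h hf

theorem integrable_exp_neg_sq [IsFiniteMeasure μ] (w : ℝ≥0) :
    Integrable (fun y : ℝ => Real.exp (-(w * y ^ 2 / 2))) μ := by
  refine Integrable.of_bound (C := 1) (by fun_prop) (.of_forall fun y => ?_)
  rw [Real.norm_of_nonneg (Real.exp_nonneg _), Real.exp_le_one_iff, neg_nonpos]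
  positivity

theorem measureReal_closedBall_le_integral_exp [IsFiniteMeasure μ] {w : ℝ≥0}
    (hw : w * s ^ 2 ≤ 1) :
    μ.real (closedBall 0 s) ≤ Real.exp (1 / 2) * ∫ y, Real.exp (-(w * y ^ 2 / 2)) ∂μ := by
  rw [← integral_indicator_one measurableSet_closedBall, ← integral_const_mul]
  refine integral_mono_of_nonneg (.of_forall fun y => ?_)
    ((integrable_exp_neg_sq w).const_mul _) (.of_forall fun y => ?_)
  · exact Set.indicator_nonneg (fun _ _ => zero_le_one) y
  · refine Set.indicator_apply_le' (fun hy => ?_) fun _ => by positivity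
    rw [mem_closedBall_zero_iff, Real.norm_eq_abs] at hy
    have hsq : w * y ^ 2 ≤ w * s ^ 2 :=
      mul_le_mul_of_nonneg_left (sq_le_sq.2 (hy.trans (le_abs_self s))) w.2
    change 1 ≤ Real.exp _ * Real.exp _
    rw [← Real.exp_add, Real.one_le_exp_iff]
    linarith

theorem exp_half_mul_pi_div_sqrt_two_pi_le : Real.exp (1 / 2) * (Real.pi / √(2 * Real.pi)) ≤ 3 := by
  have hpi := Real.pi_pos
  have hsq : (Real.exp (1 / 2) * (Real.pi / √(2 * Real.pi))) ^ 2 = Real.exp 1 * Real.pi / 2 := by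
    rw [mul_pow, div_pow, Real.sq_sqrt (by positivity), ← Real.exp_nat_mul]
    field_simp
    norm_num
  refine abs_le_of_sq_le_sq' ?_ (by norm_num) |>.2
  rw [hsq]
  nlinarith [Real.exp_one_lt_d9, Real.pi_lt_four, Real.pi_gt_three, Real.exp_pos 1]

theorem LessPeaked.measureReal_closedBall_le [IsProbabilityMeasure μ] [IsProbabilityMeasure σ]
    (h : LessPeaked μ σ) (hv : 0 < v) (hσ : ∀ t, ‖charFun σ t‖ ≤ (1 + (v * t) ^ 2)⁻¹)
    (hs : 0 < s) : μ.real (closedBall 0 s) ≤ 3 * s / v := by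
  set w : ℝ≥0 := ⟨(s ^ 2)⁻¹, by positivity⟩
  have hws : (w : ℝ) = (s ^ 2)⁻¹ := rfl
  have hw : w ≠ 0 := ne_of_gt (show (0 : ℝ) < (s ^ 2)⁻¹ by positivity)
  calc μ.real (closedBall 0 s)
      ≤ Real.exp (1 / 2) * ∫ y, Real.exp (-(w * y ^ 2 / 2)) ∂μ :=
        measureReal_closedBall_le_integral_exp (inv_mul_cancel₀ (by positivity)).le
    _ ≤ Real.exp (1 / 2) * ∫ y, Real.exp (-(w * y ^ 2 / 2)) ∂σ := by
        refine mul_le_mul_of_nonneg_left ?_ (Real.exp_nonneg _)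
        exact h.integral_le (evenUnimodal_exp_neg_sq w) (fun _ => Real.exp_nonneg _)
          (integrable_exp_neg_sq w) (integrable_exp_neg_sq w)
    _ ≤ Real.exp (1 / 2) * (Real.pi / (v * √(2 * Real.pi * w))) := by
        gcongr
        exact integral_exp_neg_sq_le_of_norm_charFun_le hv hσ hw
    _ = Real.exp (1 / 2) * (Real.pi / √(2 * Real.pi)) * (s / v) := by
        rw [hws, Real.sqrt_mul (by positivity), Real.sqrt_inv, Real.sqrt_sq hs.le]
        field_simp
    _ ≤ 3 * (s / v) := by
        gcongr
        exact exp_half_mul_pi_div_sqrt_two_pi_le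
    _ = 3 * s / v := (mul_div_assoc _ _ _).symm

section WeightedSum

variable {Ω ι : Type*} [MeasurableSpace Ω] [Fintype ι] {P : Measure Ω} {X : ι → Ω → ℝ}
  {α : EuclideanSpace ℝ ι}

theorem measureReal_abs_sum_const_mul_le_of_lessPeaked {b : ℝ} (hX : ∀ i, Measurable (X i))
    (hind : iIndepFun X P) (hsu : ∀ i, SymmUnimodal (P.map (X i))) (hb : 0 < b)
    (hpeak : ∀ i, LessPeaked (P.map (X i)) (symmUniform b ∗ symmUniform b)) (hα : α ≠ 0)
    (hs : 0 < s) : P.real {ω | |∑ i, α i * X i ω| ≤ s} ≤ 6 * s / (b * ‖α‖) := by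
  have := hind.isProbabilityMeasure
  have := isProbabilityMeasure_symmUniform hb
  set τ := symmUniform b ∗ symmUniform b
  have hτ (t : ℝ) : ‖charFun τ t‖ ≤ (1 + (b / 2 * t) ^ 2)⁻¹ := norm_charFun_symmUniform_conv_le hb t
  set Q : Measure (ι → ℝ) := Measure.pi fun _ => τ
  have hmap (i : ι) : Q.map (fun y => y i) = τ := (measurePreserving_eval _ i).map_eq
  have hYind : iIndepFun (fun i (y : ι → ℝ) => y i) Q :=
    iIndepFun_pi (X := fun _ x => x) fun _ => aemeasurable_id
  have hYsu (i : ι) : SymmUnimodal (Q.map fun y => y i) :=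
    hmap i ▸ (symmUnimodal_symmUniform b).conv (symmUnimodal_symmUniform b)
  have hpeakSum := LessPeaked.map_sum_const_mul hX hind hsu (by fun_prop) hYind hYsu
    (fun i => (hmap i).symm ▸ hpeak i) α
  have hchar := norm_charFun_map_sum_const_mul_le (fun i => by fun_prop) hYind
    (fun i t => (hmap i).symm ▸ hτ t) α
  have := Measure.isProbabilityMeasure_map (μ := P) (f := ∑ i, fun ω => α i * X i ω) (by fun_prop)
  have := Measure.isProbabilityMeasure_map (μ := Q) (f := ∑ i, fun y => α i * y i) (by fun_prop)
  have hv : 0 < b / 2 * ‖α‖ := mul_pos (half_pos hb) (norm_pos_iff.2 hα)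
  calc P.real {ω | |∑ i, α i * X i ω| ≤ s}
      = (P.map (∑ i, fun ω => α i * X i ω)).real (closedBall 0 s) :=
        (measureReal_map_sum_closedBall (fun i => (hX i).const_mul (α i)) _ s).symm
    _ ≤ 3 * s / (b / 2 * ‖α‖) := hpeakSum.measureReal_closedBall_le hv hchar hs
    _ = 6 * s / (b * ‖α‖) := by
        field_simp
        norm_num

theorem measureReal_abs_sum_const_mul_le {M : ℝ} (hX : ∀ i, Measurable (X i))
    (hind : iIndepFun X P) (hsu : ∀ i, SymmUnimodal (P.map (X i))) (hM : 0 < M)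
    (hdens : ∀ i, P.map (X i) ≤ ENNReal.ofReal M • volume) (hα : α ≠ 0) (hs : 0 < s) :
    P.real {ω | |∑ i, α i * X i ω| ≤ s} ≤ 24 * M * s / ‖α‖ := by
  have := hind.isProbabilityMeasure
  have hb : 0 < (4 * M)⁻¹ := by positivity
  have hM4 : (ENNReal.ofReal (4 * (4 * M)⁻¹))⁻¹ = ENNReal.ofReal M := by
    rw [← ENNReal.ofReal_inv_of_pos (by positivity)]
    congr 1
    field_simp
  have hpeak (i : ι) :
      LessPeaked (P.map (X i)) (symmUniform (4 * M)⁻¹ ∗ symmUniform (4 * M)⁻¹) := by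
    have := Measure.isProbabilityMeasure_map (μ := P) (hX i).aemeasurable
    exact .symmUniform_conv_of_le_smul_volume hb (hM4 ▸ hdens i)
  refine (measureReal_abs_sum_const_mul_le_of_lessPeaked hX hind hsu hb hpeak hα hs).trans_eq ?_
  field_simp
  norm_num

end WeightedSum

end AntiConcentration

section TruncGaussian

variable {a m : ℝ}

/-- The standard Gaussian law conditioned on `[-a, a]`. -/
noncomputable def truncGaussian (a : ℝ) : Measure ℝ := (gaussianReal 0 1)[|closedBall 0 a]

theorem setOf_forall_abs_le_eq_pi (ι : Type*) (a : ℝ) :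
    {x : ι → ℝ | ∀ i, |x i| ≤ a} = Set.univ.pi fun _ => closedBall 0 a := by
  ext x
  simp

theorem gaussianReal_closedBall_ne_zero (μ : ℝ) {v : ℝ≥0} (hv : v ≠ 0) (c : ℝ) (ha : 0 < a) :
    gaussianReal μ v (closedBall c a) ≠ 0 := fun hzero =>
  (measure_closedBall_pos volume c ha).ne' (gaussianReal_absolutelyContinuous' μ hv hzero)

theorem isProbabilityMeasure_truncGaussian (ha : 0 < a) :
    IsProbabilityMeasure (truncGaussian a) :=
  cond_isProbabilityMeasure (gaussianReal_closedBall_ne_zero 0 one_ne_zero 0 ha)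

theorem symmUnimodal_truncGaussian (a : ℝ) : SymmUnimodal (truncGaussian a) := by
  rw [truncGaussian, gaussianReal_of_var_ne_zero 0 one_ne_zero]
  exact .withDensity_cond (evenUnimodal_gaussianPDF 1) a

theorem truncGaussianLaw_eq_pi (n : ℕ) (ha : 0 < a) :
    truncGaussianLaw n a = Measure.pi fun _ => truncGaussian a := by
  have := isProbabilityMeasure_truncGaussian ha
  refine (Measure.pi_eq fun s _ => ?_).symm
  rw [truncGaussianLaw, setOf_forall_abs_le_eq_pi,
    cond_apply (.univ_pi fun _ => measurableSet_closedBall), ← Set.pi_inter_distrib,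
    stdGaussianLaw, Measure.pi_pi, Measure.pi_pi,
    ENNReal.prod_inv_distrib (fun i _ j _ _ => .inr (measure_ne_top _ _)),
    ← Finset.prod_mul_distrib]
  exact Finset.prod_congr rfl fun i _ => (cond_apply measurableSet_closedBall _ _).symm

theorem gaussianPDF_le_mul_gaussianReal_closedBall (hm : 0 < m) (hm1 : m ≤ 1) (hma : m ≤ a)
    (x : ℝ) :
    gaussianPDF 0 1 x ≤ ENNReal.ofReal (1 / m) * gaussianReal 0 1 (closedBall 0 a) := by
  have hpdf := evenUnimodal_gaussianPDF 1
  have hhalf : gaussianPDFReal 0 1 0 ≤ 2 * gaussianPDFReal 0 1 m := by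
    have hexp := Real.add_one_le_exp (-m ^ 2 / 2)
    simp only [gaussianPDFReal, NNReal.coe_one, mul_one, sub_zero]
    rw [zero_pow two_ne_zero, neg_zero, zero_div, Real.exp_zero, mul_left_comm]
    exact mul_le_mul_of_nonneg_left (by nlinarith) (by positivity)
  have hmass : ENNReal.ofReal (2 * m) * gaussianPDF 0 1 m ≤
      gaussianReal 0 1 (closedBall 0 a) := by
    calc ENNReal.ofReal (2 * m) * gaussianPDF 0 1 m
        = ∫⁻ _ in closedBall 0 m, gaussianPDF 0 1 m := by
          rw [setLIntegral_const, Real.volume_closedBall, mul_comm]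
      _ ≤ ∫⁻ y in closedBall 0 m, gaussianPDF 0 1 y :=
          setLIntegral_mono (measurable_gaussianPDF 0 1) fun y hy =>
            hpdf.anti ((mem_closedBall_zero_iff.1 hy).trans (le_abs_self m))
      _ = gaussianReal 0 1 (closedBall 0 m) := (gaussianReal_apply 0 one_ne_zero _).symm
      _ ≤ gaussianReal 0 1 (closedBall 0 a) := measure_mono (closedBall_subset_closedBall hma)
  calc gaussianPDF 0 1 x ≤ gaussianPDF 0 1 0 := hpdf.anti (by simp)
    _ ≤ ENNReal.ofReal (1 / m * (2 * m * gaussianPDFReal 0 1 m)) := by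
        refine ENNReal.ofReal_le_ofReal (hhalf.trans_eq ?_)
        field_simp
    _ = ENNReal.ofReal (1 / m) * (ENNReal.ofReal (2 * m) * gaussianPDF 0 1 m) := by
        rw [ENNReal.ofReal_mul (by positivity), ENNReal.ofReal_mul (by positivity), gaussianPDF]
    _ ≤ _ := by gcongr

theorem truncGaussian_le_smul_volume (hm : 0 < m) (hm1 : m ≤ 1) (hma : m ≤ a) :
    truncGaussian a ≤ ENNReal.ofReal (1 / m) • volume := by
  have hdens : gaussianReal 0 1 ≤
      (ENNReal.ofReal (1 / m) * gaussianReal 0 1 (closedBall 0 a)) • volume := by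
    conv_lhs => rw [gaussianReal_of_var_ne_zero 0 one_ne_zero]
    rw [← withDensity_const]
    exact withDensity_mono
      (.of_forall (gaussianPDF_le_mul_gaussianReal_closedBall hm hm1 hma))
  have hne : gaussianReal 0 1 (closedBall 0 a) ≠ 0 :=
    gaussianReal_closedBall_ne_zero 0 one_ne_zero 0 (hm.trans_le hma)
  calc truncGaussian a
      ≤ (gaussianReal 0 1 (closedBall 0 a))⁻¹ • gaussianReal 0 1 :=
        smul_mono_right _ Measure.restrict_le_self
    _ ≤ (gaussianReal 0 1 (closedBall 0 a))⁻¹ •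
          (ENNReal.ofReal (1 / m) * gaussianReal 0 1 (closedBall 0 a)) • volume :=
        smul_mono_right _ hdens
    _ = ENNReal.ofReal (1 / m) • volume := by
        rw [smul_smul, mul_comm, mul_assoc, ENNReal.mul_inv_cancel hne (measure_ne_top _ _),
          mul_one]

theorem measureReal_smallBall_le {n : ℕ} {α : EuclideanSpace ℝ (Fin n)} {δ : ℝ} (hα : α ≠ 0)
    (ha : 0 < a) (hδ : 0 < δ) : (truncGaussianLaw n a).real (smallBall α a δ) ≤ 24 * δ := by
  set m := min a (1 / 10)
  have hm0 : 0 < m := lt_min ha (by norm_num)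
  have hm1 : m ≤ 1 := (min_le_right _ _).trans (by norm_num)
  have : 0 < ‖α‖ := norm_pos_iff.2 hα
  have := isProbabilityMeasure_truncGaussian ha
  have hmap (i : Fin n) : (truncGaussianLaw n a).map (fun x => x i) = truncGaussian a :=
    truncGaussianLaw_eq_pi n ha ▸ (measurePreserving_eval _ i).map_eq
  have hind : iIndepFun (fun i (x : Fin n → ℝ) => x i) (truncGaussianLaw n a) :=
    truncGaussianLaw_eq_pi n ha ▸ iIndepFun_pi (X := fun _ x => x) fun _ => aemeasurable_id
  have hcube : MeasurableSet {x : Fin n → ℝ | ∀ i, |x i| ≤ a} := by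
    rw [setOf_forall_abs_le_eq_pi]
    exact .univ_pi fun _ => measurableSet_closedBall
  have huntrunc : smallBall α a δ =ᵐ[truncGaussianLaw n a]
      {x | |∑ i, α i * x i| ≤ m * δ * ‖α‖} := by
    filter_upwards [ae_cond_mem hcube] with x hx
    have htrunc (i : Fin n) : trunc a (x i) = x i := if_pos (hx i)
    refine propext ?_
    change |∑ i, α i * trunc a (x i)| ≤ m * δ * ‖α‖ ↔ _
    simp only [htrunc]
    rfl
  calc (truncGaussianLaw n a).real (smallBall α a δ)
      = (truncGaussianLaw n a).real {x | |∑ i, α i * x i| ≤ m * δ * ‖α‖} :=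
        measureReal_congr huntrunc
    _ ≤ 24 * (1 / m) * (m * δ * ‖α‖) / ‖α‖ :=
        measureReal_abs_sum_const_mul_le (fun i => measurable_pi_apply i) hind
          (fun i => hmap i ▸ symmUnimodal_truncGaussian a) (by positivity)
          (fun i => hmap i ▸ truncGaussian_le_smul_volume hm0 hm1 (min_le_left _ _)) hα
          (by positivity)
    _ = 24 * δ := by field_simp

end TruncGaussian

theorem mainTheorem3 :
    (∃ c : ℝ, 0 < c ∧
      ∀ (n : ℕ) (α : EuclideanSpace ℝ (Fin n)) (a δ : ℝ), 0 < a → 0 < δ → δ ≤ 1 →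
        c * δ ≤ (stdGaussianLaw n).real (smallBall α a δ)) ∧
    (∃ C : ℝ, 0 < C ∧
      ∀ (n : ℕ) (α : EuclideanSpace ℝ (Fin n)) (a δ : ℝ), α ≠ 0 → 0 < a → 0 < δ →
        (truncGaussianLaw n a).real (smallBall α a δ) ≤ C * δ) :=
  ⟨⟨1 / 40, by norm_num, fun _ α _ _ ha hδ hδ1 => le_measureReal_smallBall α ha hδ hδ1⟩,
    ⟨24, by norm_num, fun _ _ _ _ hα ha hδ => measureReal_smallBall_le hα ha hδ⟩⟩
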